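/- For every integer $d\ge 0$ there exists a constant $L_d\in(0,\infty)$, depending only on $d$, such that the following holds. Let $n\ge 0$ be an integer and let $F$ be a real normed space (for example $F=\mathbb{R}$). For $j=0,1,\ldots,d$ let $(a^{j}_{i_1,\ldots,i_j})_{1\le i_1,\ldots,i_j\le n}$ be a $j$-indexed array of elements of $F$ that is symmetric (invariant under permutations of the indices) and satisfies $a^{j}_{i_1,\ldots,i_j}=0$ whenever $i_k=i_l$ for some $1\le k<l\le j$ (for $j=0$ this is a single element $a^{0}_{\emptyset}\in F$). Let $X_1,\ldots,X_n$ be independent, integrable real random variables with mean zero. Then for all real $p\ge 1$, $$ \sum_{j=0}^d \Big\|\sum_{i_1,\ldots,i_j=1}^n a_{i_1,\ldots,i_j}^{j}X_{i_1}\cdots X_{i_j}\Big\|_p \le L_d \Big\|\sum_{j=0}^d\sum_{i_1,\ldots,i_j=1}^n a_{i_1,\ldots,i_j}^{j}X_{i_1}\cdots X_{i_j}\Big\|_p , $$ where $\|Y\|_p=(\mathbb{E}\|Y\|_F^p)^{1/p}\in[0,\infty]$. In particular, if the right-hand side is finite, then so is the left-hand side. -/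

import Mathlib

open MeasureTheory ProbabilityTheory

/-- A `j`-indexed array `(a_{i₁,…,iⱼ})` with `1 ≤ i₁,…,iⱼ ≤ n` is symmetric if it is invariant
under every permutation of the `j` positions. -/
def IsSymmetricArray {F : Type*} {n j : ℕ} (a : (Fin j → Fin n) → F) : Prop :=
  ∀ (σ : Equiv.Perm (Fin j)) (i : Fin j → Fin n), a (i ∘ σ) = a i

/-- The array has no diagonal entries: `a_{i₁,…,iⱼ} = 0` whenever `i_k = i_l` for some `k < l`. -/
def VanishesOnDiagonals {F : Type*} [Zero F] {n j : ℕ} (a : (Fin j → Fin n) → F) : Prop :=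
  ∀ i : Fin j → Fin n, (∃ k l : Fin j, k < l ∧ i k = i l) → a i = 0

/-- The homogeneous polynomial chaos of order `j`,
`∑_{i₁,…,iⱼ = 1}^n a_{i₁,…,iⱼ} X_{i₁} ⋯ X_{iⱼ}`, with coefficients in a real normed space.
For `j = 0` it is the constant `a_∅`. -/
def homogeneousChaos {Ω F : Type*} [NormedAddCommGroup F] [NormedSpace ℝ F] {n j : ℕ}
    (a : (Fin j → Fin n) → F) (X : Fin n → Ω → ℝ) (ω : Ω) : F :=
  ∑ i : Fin j → Fin n, (∏ k : Fin j, X (i k) ω) • a i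

/-! By independence the vector `X` has a product law, and since diagonal coefficients vanish the
full chaos f is a polynomial affine in each coordinate. Setting a mean-zero coordinate to 0 then
amounts to averaging over it, which does not increase the L^p norm (Jensen). Scaling a coordinate by
t in [0,1] is a convex combination of doing this and doing nothing, so ‖f(t·)‖_p ≤ ‖f‖_p. As f(tx) =
∑ t^j Q_j(x) with Q_j the homogeneous parts, inverting a Vandermonde matrix at d + 1 nodes in [0,1]
recovers each Q_j from the f(t_k x), with coefficients depending only on d. -/

open Finset in
theorem exists_update_prod_eq {n j : ℕ} {i : Fin j → Fin n} (hi : Function.Injective i)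
    (x : Fin n → ℝ) (m : Fin n) :
    ∃ u v : ℝ, ∀ s : ℝ, ∏ k, Function.update x m s (i k) = u + s * v := by
  by_cases h : ∃ k, i k = m
  · obtain ⟨k, rfl⟩ := h
    refine ⟨0, ∏ l ∈ univ.erase k, x (i l), fun s => ?_⟩
    rw [← mul_prod_erase univ _ (mem_univ k), Function.update_self, zero_add]
    congr 1
    refine prod_congr rfl fun l hl => Function.update_of_ne (fun e => ?_) _ _
    exact (mem_erase.mp hl).1 (hi e)
  · push Not at h
    refine ⟨∏ k, x (i k), 0, fun s => ?_⟩
    rw [mul_zero, add_zero]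
    exact prod_congr rfl fun l _ => Function.update_of_ne (h l) _ _

/-- A function of `n` real variables which is affine in each variable separately. -/
def IsMultiAffine {n : ℕ} {F : Type*} [NormedAddCommGroup F] [NormedSpace ℝ F]
    (g : (Fin n → ℝ) → F) : Prop :=
  ∀ (x : Fin n → ℝ) (m : Fin n), ∃ u v : F, ∀ s : ℝ, g (Function.update x m s) = u + s • v

section

variable {F : Type*} [NormedAddCommGroup F] [NormedSpace ℝ F] {n : ℕ}

theorem IsMultiAffine.sum {ι : Type*} (s : Finset ι) {g : ι → (Fin n → ℝ) → F}
    (hg : ∀ i ∈ s, IsMultiAffine (g i)) : IsMultiAffine fun x => ∑ i ∈ s, g i x := by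
  intro x m
  choose! u v h using fun i hi => hg i hi x m
  refine ⟨∑ i ∈ s, u i, ∑ i ∈ s, v i, fun r => ?_⟩
  rw [Finset.smul_sum, ← Finset.sum_add_distrib]
  exact Finset.sum_congr rfl fun i hi => h i hi r

theorem IsMultiAffine.comp_mul {g : (Fin n → ℝ) → F} (hg : IsMultiAffine g) (c : Fin n → ℝ) :
    IsMultiAffine fun x => g (c * x) := by
  intro x m
  obtain ⟨u, v, h⟩ := hg (c * x) m
  refine ⟨u, c m • v, fun s => ?_⟩
  have : c * Function.update x m s = Function.update (c * x) m (c m * s) := by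
    ext k
    rcases eq_or_ne k m with rfl | hk
    · simp
    · simp [hk]
  simp only [this, h, smul_smul, mul_comm]

theorem VanishesOnDiagonals.isMultiAffine {j : ℕ} {a : (Fin j → Fin n) → F}
    (ha : VanishesOnDiagonals a) :
    IsMultiAffine (homogeneousChaos a fun i (x : Fin n → ℝ) => x i) := by
  refine IsMultiAffine.sum Finset.univ fun i _ x m => ?_
  by_cases hi : Function.Injective i
  · obtain ⟨u, v, h⟩ := exists_update_prod_eq hi x m
    exact ⟨u • a i, v • a i, fun s => by rw [h, add_smul, smul_smul]⟩
  · have : a i = 0 := by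
      simp only [Function.Injective] at hi
      push Not at hi
      obtain ⟨k, l, h, hne⟩ := hi
      rcases lt_or_gt_of_ne hne with hlt | hlt
      · exact ha i ⟨k, l, hlt, h⟩
      · exact ha i ⟨l, k, hlt, h.symm⟩
    exact ⟨0, 0, fun s => by simp [this]⟩

theorem continuous_homogeneousChaos {j : ℕ} (a : (Fin j → Fin n) → F) :
    Continuous (homogeneousChaos a fun i (x : Fin n → ℝ) => x i) := by
  unfold homogeneousChaos
  fun_prop

theorem homogeneousChaos_const_mul {j : ℕ} (a : (Fin j → Fin n) → F) (t : ℝ) (x : Fin n → ℝ) :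
    homogeneousChaos a (fun i (x : Fin n → ℝ) => x i) ((fun _ => t) * x) =
      t ^ j • homogeneousChaos a (fun i (x : Fin n → ℝ) => x i) x := by
  simp only [homogeneousChaos, Pi.mul_apply, Finset.prod_mul_distrib, Finset.prod_const,
    Finset.card_univ, Fintype.card_fin, Finset.smul_sum, smul_smul]

/-- Jensen's inequality. Integrating a norming functional of u instead of the vector itself avoids
any completeness assumption on `F`. -/
theorem enorm_rpow_le_lintegral_add_smul {ν : Measure ℝ} [IsProbabilityMeasure ν]
    (hν : Integrable (fun s : ℝ => s) ν) (hν0 : ∫ s, s ∂ν = 0) {p : ℝ} (hp : 1 ≤ p) (u v : F) :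
    ‖u‖ₑ ^ p ≤ ∫⁻ s, ‖u + s • v‖ₑ ^ p ∂ν := by
  have hint : Integrable (fun s : ℝ => u + s • v) ν :=
    (integrable_const u).add (Integrable.smul_const hν v)
  have h1 : ‖u‖ₑ ≤ eLpNorm (fun s : ℝ => u + s • v) 1 ν := by
    obtain ⟨φ, hφ, hφu⟩ := exists_dual_vector'' ℝ u
    have key : ‖u‖ ≤ ∫ s, ‖u + s • v‖ ∂ν := by
      calc ‖u‖ = ∫ s, (φ u + s * φ v) ∂ν := by
            rw [integral_add (integrable_const _) (Integrable.mul_const hν _),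
              integral_mul_const, hν0]
            simp [hφu]
        _ ≤ ∫ s, ‖u + s • v‖ ∂ν := by
            refine integral_mono ((integrable_const _).add (Integrable.mul_const hν _))
              hint.norm fun s => ?_
            have : φ u + s * φ v = φ (u + s • v) := by simp
            simp only [this]
            calc φ (u + s • v) ≤ ‖φ (u + s • v)‖ := le_abs_self _
              _ ≤ 1 * ‖u + s • v‖ := φ.le_of_opNorm_le hφ _
              _ = _ := one_mul _
    rw [eLpNorm_one_eq_lintegral_enorm, ← ofReal_integral_norm_eq_lintegral_enorm hint,
      ← ofReal_norm]
    exact ENNReal.ofReal_le_ofReal key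
  have h2 := h1.trans (eLpNorm_le_eLpNorm_of_exponent_le
    (ENNReal.one_le_ofReal.mpr hp) hint.aestronglyMeasurable)
  have hp0 : 0 < p := one_pos.trans_le hp
  rw [eLpNorm_eq_lintegral_rpow_enorm_toReal (by simpa using hp0) ENNReal.ofReal_ne_top,
    ENNReal.toReal_ofReal hp0.le, one_div, ENNReal.le_rpow_inv_iff hp0] at h2
  exact h2

variable {ν : Fin n → Measure ℝ} [∀ i, IsProbabilityMeasure (ν i)]

theorem IsMultiAffine.eLpNorm_update_zero_le {g : (Fin n → ℝ) → F} (hg : IsMultiAffine g)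
    (hgc : Continuous g) (hν : ∀ i, Integrable (fun s : ℝ => s) (ν i)) (hν0 : ∀ i, ∫ s, s ∂(ν i) = 0)
    {p : ℝ} (hp : 1 ≤ p) (m : Fin n) :
    eLpNorm (fun x => g (Function.update x m 0)) (ENNReal.ofReal p) (Measure.pi ν) ≤
      eLpNorm g (ENNReal.ofReal p) (Measure.pi ν) := by
  have hp0 : 0 < p := one_pos.trans_le hp
  rw [eLpNorm_eq_lintegral_rpow_enorm_toReal (by simpa using hp0) ENNReal.ofReal_ne_top,
    eLpNorm_eq_lintegral_rpow_enorm_toReal (by simpa using hp0) ENNReal.ofReal_ne_top,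
    ENNReal.toReal_ofReal hp0.le]
  refine ENNReal.rpow_le_rpow ?_ (by positivity)
  -- By Fubini it suffices to compare the integrals over coordinate m with the others frozen.
  refine lintegral_le_of_lmarginal_le (s := {m}) (μ := ν) ?_ ?_ fun x => ?_
  · exact ((hgc.comp (continuous_id.update m continuous_const)).enorm.measurable).pow_const p
  · exact hgc.enorm.measurable.pow_const p
  · obtain ⟨u, v, h⟩ := hg x m
    simp only [lmarginal_singleton, Function.update_idem, h, zero_smul, add_zero,
      lintegral_const, measure_univ, mul_one]
    exact enorm_rpow_le_lintegral_add_smul (hν m) (hν0 m) hp u v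

theorem IsMultiAffine.eLpNorm_update_mul_le {g : (Fin n → ℝ) → F} (hg : IsMultiAffine g)
    (hgc : Continuous g) (hν : ∀ i, Integrable (fun s : ℝ => s) (ν i)) (hν0 : ∀ i, ∫ s, s ∂(ν i) = 0)
    {p : ℝ} (hp : 1 ≤ p) {t : ℝ} (ht : t ∈ Set.Icc (0 : ℝ) 1) (m : Fin n) :
    eLpNorm (fun x => g (Function.update x m (t * x m))) (ENNReal.ofReal p) (Measure.pi ν) ≤
      eLpNorm g (ENNReal.ofReal p) (Measure.pi ν) := by
  have hgu : Continuous fun x : Fin n → ℝ => g (Function.update x m 0) :=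
    hgc.comp (continuous_id.update m continuous_const)
  -- Affinity in coordinate m: u + t x_m v = (1 - t) u + t (u + x_m v).
  have heq : (fun x => g (Function.update x m (t * x m))) =
      (1 - t) • (fun x : Fin n → ℝ => g (Function.update x m 0)) + t • g := by
    ext x
    obtain ⟨u, v, h⟩ := hg x m
    have hx : g x = u + x m • v := by rw [← h, Function.update_eq_self]
    simp only [Pi.add_apply, Pi.smul_apply, h, hx]
    module
  rw [heq]
  refine (eLpNorm_add_le (hgu.const_smul _).aestronglyMeasurable
    (hgc.const_smul t).aestronglyMeasurable (ENNReal.one_le_ofReal.mpr hp)).trans ?_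
  rw [eLpNorm_const_smul, eLpNorm_const_smul]
  calc _ ≤ ‖1 - t‖ₑ * eLpNorm g (ENNReal.ofReal p) (Measure.pi ν) +
        ‖t‖ₑ * eLpNorm g (ENNReal.ofReal p) (Measure.pi ν) := by
        gcongr
        exact hg.eLpNorm_update_zero_le hgc hν hν0 hp m
    _ = _ := by
      rw [← add_mul, Real.enorm_of_nonneg (sub_nonneg.mpr ht.2), Real.enorm_of_nonneg ht.1,
        ← ENNReal.ofReal_add (sub_nonneg.mpr ht.2) ht.1]
      simp

theorem IsMultiAffine.eLpNorm_const_mul_le {g : (Fin n → ℝ) → F} (hg : IsMultiAffine g)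
    (hgc : Continuous g) (hν : ∀ i, Integrable (fun s : ℝ => s) (ν i)) (hν0 : ∀ i, ∫ s, s ∂(ν i) = 0)
    {p : ℝ} (hp : 1 ≤ p) {t : ℝ} (ht : t ∈ Set.Icc (0 : ℝ) 1) :
    eLpNorm (fun x => g ((fun _ => t) * x)) (ENNReal.ofReal p) (Measure.pi ν) ≤
      eLpNorm g (ENNReal.ofReal p) (Measure.pi ν) := by
  -- Coordinates are scaled one at a time; each step preserves multi-affinity.
  suffices h : ∀ S : Finset (Fin n),
      eLpNorm (fun x => g ((fun i => if i ∈ S then t else 1) * x))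
        (ENNReal.ofReal p) (Measure.pi ν) ≤ eLpNorm g (ENNReal.ofReal p) (Measure.pi ν) by
    simpa using h Finset.univ
  intro S
  induction S using Finset.induction_on with
  | empty =>
    refine le_of_eq (congrArg (eLpNorm · _ _) (funext fun x => congrArg g ?_))
    ext i
    simp
  | insert m S hm ih =>
    refine le_trans (le_of_eq ?_) (((hg.comp_mul _).eLpNorm_update_mul_le
      (by fun_prop) hν hν0 hp ht m).trans ih)
    refine congrArg (eLpNorm · _ _) (funext fun x => congrArg g ?_)
    ext i
    rcases eq_or_ne i m with rfl | hi
    · simp [hm]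
    · simp [hi]

theorem sum_eLpNorm_homogeneousChaos_pi_le {d : ℕ} {t : Fin (d + 1) → ℝ}
    {c : Fin (d + 1) → Fin (d + 1) → ℝ} (ht : ∀ k, t k ∈ Set.Icc (0 : ℝ) 1)
    (hc : ∀ j j' : Fin (d + 1), ∑ k, c j k * t k ^ (j' : ℕ) = if j = j' then 1 else 0)
    {a : (j : ℕ) → (Fin j → Fin n) → F} (ha : ∀ j ≤ d, VanishesOnDiagonals (a j))
    (hν : ∀ i, Integrable (fun s : ℝ => s) (ν i)) (hν0 : ∀ i, ∫ s, s ∂(ν i) = 0)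
    {p : ℝ} (hp : 1 ≤ p) :
    ∑ j ∈ Finset.range (d + 1), eLpNorm (homogeneousChaos (a j) fun i (x : Fin n → ℝ) => x i)
        (ENNReal.ofReal p) (Measure.pi ν) ≤
      ENNReal.ofReal (∑ j, ∑ k, |c j k|) *
        eLpNorm (fun x : Fin n → ℝ => ∑ j ∈ Finset.range (d + 1),
          homogeneousChaos (a j) (fun i (x : Fin n → ℝ) => x i) x)
          (ENNReal.ofReal p) (Measure.pi ν) := by
  set Q : ℕ → (Fin n → ℝ) → F := fun j => homogeneousChaos (a j) fun i x => x i with hQdef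
  set f : (Fin n → ℝ) → F := fun x => ∑ j ∈ Finset.range (d + 1), Q j x with hfdef
  have hQc : ∀ j, Continuous (Q j) := fun j => continuous_homogeneousChaos (a j)
  have hfc : Continuous f := continuous_finsetSum _ fun j _ => hQc j
  have hf : IsMultiAffine f := IsMultiAffine.sum _ fun j hj =>
    (ha j (Nat.lt_succ_iff.mp (Finset.mem_range.mp hj))).isMultiAffine
  have hscale : ∀ (s : ℝ) x, f ((fun _ => s) * x) = ∑ j : Fin (d + 1), s ^ (j : ℕ) • Q j x := by
    intro s x
    simp only [hfdef, hQdef, homogeneousChaos_const_mul]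
    exact Finset.sum_range fun j => s ^ j • Q j x
  -- `hc` says that c inverts the Vandermonde matrix of t, so this combination cancels every degree
  -- but j.
  have hQ : ∀ j : Fin (d + 1), Q j = ∑ k, c j k • fun x => f ((fun _ => t k) * x) := by
    intro j
    ext x
    simp only [Finset.sum_apply, Pi.smul_apply, hscale, Finset.smul_sum, smul_smul]
    rw [Finset.sum_comm]
    simp only [← Finset.sum_smul, hc]
    simp
  have hle : ∀ j : Fin (d + 1), eLpNorm (Q j) (ENNReal.ofReal p) (Measure.pi ν) ≤
      ENNReal.ofReal (∑ k, |c j k|) * eLpNorm f (ENNReal.ofReal p) (Measure.pi ν) := by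
    intro j
    rw [hQ j, ENNReal.ofReal_sum_of_nonneg fun _ _ => abs_nonneg _, Finset.sum_mul]
    refine (eLpNorm_sum_le (fun k _ => Continuous.aestronglyMeasurable (by fun_prop))
      (ENNReal.one_le_ofReal.mpr hp)).trans (Finset.sum_le_sum fun k _ => ?_)
    rw [eLpNorm_const_smul, Real.enorm_eq_ofReal_abs]
    gcongr
    exact hf.eLpNorm_const_mul_le hfc hν hν0 hp (ht k)
  rw [Finset.sum_range]
  refine (Finset.sum_le_sum fun j _ => hle j).trans ?_
  rw [← Finset.sum_mul, ← ENNReal.ofReal_sum_of_nonneg fun _ _ => by positivity]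

end

theorem exists_vandermonde_inverse (d : ℕ) :
    ∃ (t : Fin (d + 1) → ℝ) (c : Fin (d + 1) → Fin (d + 1) → ℝ),
      (∀ k, t k ∈ Set.Icc (0 : ℝ) 1) ∧
        ∀ j j' : Fin (d + 1), ∑ k, c j k * t k ^ (j' : ℕ) = if j = j' then 1 else 0 := by
  -- Any d + 1 distinct nodes in [0,1] would do.
  let t : Fin (d + 1) → ℝ := fun k => (k : ℝ) / (d + 1)
  have hd : (0 : ℝ) < d + 1 := by positivity
  have hinj : Function.Injective t := fun k l h => by
    have := (div_left_inj' hd.ne').mp h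
    exact Fin.ext (by exact_mod_cast this)
  refine ⟨t, ((Matrix.vandermonde t)⁻¹ : Matrix _ _ ℝ), fun k => ⟨by positivity, ?_⟩, fun j j' => ?_⟩
  · rw [div_le_one hd]
    exact_mod_cast k.2.le
  · have hdet : IsUnit (Matrix.vandermonde t).det :=
      (Matrix.det_vandermonde_ne_zero_iff.mpr hinj).isUnit
    have := congrFun (congrFun (Matrix.nonsing_inv_mul _ hdet) j) j'
    simpa [Matrix.mul_apply, Matrix.one_apply, Matrix.vandermonde_apply] using this

theorem mainTheorem5 (d : ℕ) :
    ∃ L : ℝ, 0 < L ∧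
      ∀ (Ω : Type*) [MeasurableSpace Ω] (μ : Measure Ω) [IsProbabilityMeasure μ]
        (F : Type*) [NormedAddCommGroup F] [NormedSpace ℝ F]
        (n : ℕ) (a : (j : ℕ) → (Fin j → Fin n) → F) (X : Fin n → Ω → ℝ),
        (∀ j ≤ d, IsSymmetricArray (a j)) →
        (∀ j ≤ d, VanishesOnDiagonals (a j)) →
        iIndepFun X μ →
        (∀ i, Integrable (X i) μ ∧ ∫ ω, X i ω ∂μ = 0) →
        ∀ p : ℝ, 1 ≤ p →
          ∑ j ∈ Finset.range (d + 1),
              eLpNorm (fun ω => homogeneousChaos (a j) X ω) (ENNReal.ofReal p) μ ≤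
            ENNReal.ofReal L *
              eLpNorm (fun ω => ∑ j ∈ Finset.range (d + 1), homogeneousChaos (a j) X ω)
                (ENNReal.ofReal p) μ := by
  obtain ⟨t, c, ht, hc⟩ := exists_vandermonde_inverse d
  -- The summand 1 only makes positivity immediate.
  refine ⟨1 + ∑ j, ∑ k, |c j k|, by positivity, ?_⟩
  intro Ω _ μ _ F _ _ n a X _ ha hX hX0 p hp
  have hXm : ∀ i, AEMeasurable (X i) μ := fun i => (hX0 i).1.aemeasurable
  have hXm' : AEMeasurable (fun ω i => X i ω) μ := aemeasurable_pi_lambda _ hXm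
  set ν : Fin n → Measure ℝ := fun i => μ.map (X i) with hνdef
  have hprob : ∀ i, IsProbabilityMeasure (ν i) := fun i =>
    Measure.isProbabilityMeasure_map (hXm i)
  have hmap : μ.map (fun ω i => X i ω) = Measure.pi ν :=
    (iIndepFun_iff_map_fun_eq_pi_map hXm).mp hX
  have hν : ∀ i, Integrable (fun s : ℝ => s) (ν i) := fun i =>
    (integrable_map_measure aestronglyMeasurable_id (hXm i)).mpr (hX0 i).1
  have hν0 : ∀ i, ∫ s, s ∂(ν i) = 0 := fun i =>
    (integral_map (hXm i) aestronglyMeasurable_id).trans (hX0 i).2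
  have transfer : ∀ g : (Fin n → ℝ) → F, Continuous g →
      eLpNorm (fun ω => g fun i => X i ω) (ENNReal.ofReal p) μ =
        eLpNorm g (ENNReal.ofReal p) (Measure.pi ν) := fun g hg => by
    rw [← hmap, eLpNorm_map_measure hg.aestronglyMeasurable hXm']
    rfl
  calc _ = ∑ j ∈ Finset.range (d + 1),
        eLpNorm (homogeneousChaos (a j) fun i (x : Fin n → ℝ) => x i)
          (ENNReal.ofReal p) (Measure.pi ν) :=
        Finset.sum_congr rfl fun j _ => transfer _ (continuous_homogeneousChaos (a j))
    _ ≤ _ := sum_eLpNorm_homogeneousChaos_pi_le ht hc ha hν hν0 hp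
    _ ≤ ENNReal.ofReal (1 + ∑ j, ∑ k, |c j k|) * _ := by
        gcongr
        linarith
    _ = _ := congrArg _ (transfer _ (continuous_finsetSum _ fun j _ =>
        continuous_homogeneousChaos (a j))).symm
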